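/- Let $(\phi_n)_{n\ge 0}$ be an i.i.d. sequence of random variables with values in $[0,1]$, let $(Z_n)_{n\ge 0}$ be an i.i.d. sequence of random variables with values in $\{0,1,2,\dots\}$, and let $(B_{n,k})_{n,k\ge 0}$ be $\{0,1\}$-valued random variables such that, conditionally on $(\phi_n)$, the $B_{n,k}$ are independent with $P(B_{n,k}=1\mid(\phi_m)_m)=\phi_n$; the pair $((\phi_n),(B_{n,k}))$ is independent of $(Z_n)$. Let $X_0=0$ and $$X_n=\sum_{k=1}^{X_{n-1}}B_{n,k}+Z_n,\qquad n\ge 1.$$ Assume that $P(\phi_0=1)<1$ and that for some $\alpha>0$ there is a function $h:(0,\infty)\to\mathbb R$, regularly varying at infinity with index $\alpha$ (that is, $h(t)=t^\alpha L(t)$ with $\lim_{t\to\infty}L(\lambda t)/L(t)=1$ for every $\lambda>0$), such that $\lim_{t\to\infty}h(t)P(Z_0>t)=1$ and $\sup_{t>0}h(t)P(Z_0>t)<\infty$. Put $M_n=\max\{X_1,\dots,X_n\}$ and $b_n=\inf\{t>0:h(t)\ge n\}$. Then $M_n/b_n$ converges in distribution to a (proper) real random variable $M_\infty$ with the Fréchet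 distribution function $$P(M_\infty\le x)=e^{-x^{-\alpha}},\qquad x>0.$$ The maxima of the innovations, $\max\{Z_1,\dots,Z_n\}/b_n$, converge in distribution to the same limit. The limit law depends only on $\alpha$; in particular, it does not depend on the law of $\phi_0$. -/

import Mathlib

open MeasureTheory ProbabilityTheory Filter Topology

/-- `f` is regularly varying (at infinity) with index `α`: on `(0, ∞)`, `f t = t ^ α * L t` for a
slowly varying function `L`. Only the values of `f` on `(0, ∞)` matter. -/
def RegularlyVarying (α : ℝ) (f : ℝ → ℝ) : Prop :=
  ∃ L : ℝ → ℝ, (∀ t : ℝ, 0 < t → f t = t ^ α * L t) ∧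
    ∀ c : ℝ, 0 < c → Tendsto (fun t : ℝ => L (c * t) / L t) atTop (𝓝 1)

/-- The random coefficients of an RCINAR(1) process: `φ` is an i.i.d. sequence with values in
`[0, 1]`, `Z` is an i.i.d. sequence with values in `ℕ`, and, given `φ`, the zero-one valued
variables `B n k` are independent with `P (B n k = 1 | φ) = φ n`. The pair `(φ, B)` is
independent of `Z`. -/
structure RCINARCoefficients {Ω : Type*} [MeasurableSpace Ω] (μ : Measure Ω)
    (φ : ℕ → Ω → ℝ) (Z : ℕ → Ω → ℕ) (B : ℕ → ℕ → Ω → ℕ) : Prop where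
  measurable_φ : ∀ n, Measurable (φ n)
  measurable_Z : ∀ n, Measurable (Z n)
  measurable_B : ∀ n k, Measurable (B n k)
  φ_mem : ∀ n ω, φ n ω ∈ Set.Icc (0 : ℝ) 1
  B_mem : ∀ n k ω, B n k ω = 0 ∨ B n k ω = 1
  indep_φ : iIndepFun φ μ
  identDistrib_φ : ∀ n, IdentDistrib (φ n) (φ 0) μ μ
  indep_Z : iIndepFun Z μ
  identDistrib_Z : ∀ n, IdentDistrib (Z n) (Z 0) μ μ
  /-- The conditional finite-dimensional distributions of the family `B` given `φ`. -/
  condProb_B : ∀ (S : Finset (ℕ × ℕ)) (e : ℕ × ℕ → Bool),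
    μ[Set.indicator {ω | ∀ p ∈ S, B p.1 p.2 ω = (e p).toNat} (fun _ => (1 : ℝ)) |
        MeasurableSpace.comap (fun (ω : Ω) (n : ℕ) => φ n ω) inferInstance]
      =ᵐ[μ] fun ω => ∏ p ∈ S, if e p then φ p.1 ω else 1 - φ p.1 ω
  indep_φB_Z : IndepFun
    (fun ω : Ω => ((fun n : ℕ => φ n ω), (fun n k : ℕ => B n k ω)))
    (fun (ω : Ω) (n : ℕ) => Z n ω) μ

/-- The RCINAR(1) process started from `X 0 = 0`:
`X n = ∑ k = 1, …, X (n - 1), B n k + Z n` for `n ≥ 1`. -/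
def rcinar {Ω : Type*} (Z : ℕ → Ω → ℕ) (B : ℕ → ℕ → Ω → ℕ) : ℕ → Ω → ℕ
  | 0, _ => 0
  | n + 1, ω => (∑ k ∈ Finset.Icc 1 (rcinar Z B n ω), B (n + 1) k ω) + Z (n + 1) ω

/-- The running maximum `max {Y 1, …, Y n}` of a sequence with values in `ℕ`. -/
def runningMax {Ω : Type*} (Y : ℕ → Ω → ℕ) (n : ℕ) (ω : Ω) : ℕ :=
  (Finset.Icc 1 n).sup fun k => Y k ω

/-- The normalizing constants `b n = inf {t > 0 : h t ≥ n}`. -/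
noncomputable def normalizer (h : ℝ → ℝ) (n : ℕ) : ℝ :=
  sInf {t : ℝ | 0 < t ∧ (n : ℝ) ≤ h t}

/-- The assumption on the law of the coefficients: the thinning probabilities are not
almost surely equal to one, and the tails of the innovations are regularly varying,
`P (Z > t) ∼ 1 / h t` with `h` regularly varying of index `α > 0` and
`sup_{t > 0} h t * P (Z > t) < ∞`. -/
structure HeavyTailAssumption {Ω : Type*} [MeasurableSpace Ω] (μ : Measure Ω)
    (φ : ℕ → Ω → ℝ) (Z : ℕ → Ω → ℕ) (α : ℝ) (h : ℝ → ℝ) : Prop where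
  prob_φ_eq_one_lt : μ {ω | φ 0 ω = 1} < 1
  α_pos : 0 < α
  regularlyVarying : RegularlyVarying α h
  tendsto_tail : Tendsto (fun t : ℝ => h t * μ.real {ω | t < (Z 0 ω : ℝ)}) atTop (𝓝 1)
  bddAbove_tail : BddAbove ((fun t : ℝ => h t * μ.real {ω | t < (Z 0 ω : ℝ)}) '' Set.Ioi 0)

/-! With `F` the tail of the innovations and `b n` the normalizer, regular variation gives `n * F (x
* b n) → x ^ (-α)` (`tendsto_mul_tail_normalizer`), so the innovations have a Fréchet limit. Since
`X k ≥ Z k`, it remains to show that the maximum of the process exceeds theirs by only `o(b n)` in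
probability (`tendsto_measureReal_runningMax_add_lt`).

Replace innovations above `δ * b n` by zero, keeping the same thinning variables; call the new
process `S`. Small innovations and thinning never widen the gap `X - S`, and a large innovation that
meets a state at most `ε * b n` resets the bound on `X`. Hence `X ≤ S + ε * b n + max Z` unless a
large innovation meets a large state (`rcinar_le_rcinar_natTrunc_add`).

Both errors are controlled by a moment of order `p > α`. Thinning multiplies `p`-th moments by at
most `E φ < 1`, so Minkowski bounds those of `S` uniformly in time
(`exists_lintegral_rcinar_pow_le`). A Karamata estimate and Markov's inequality then bound the
probability that `S` is large at some time up to `n` by order `δ ^ (p - α)` in the limit. The other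
event has limiting bound `δ ^ (-α) * K ^ (-α)`, by independence and a second truncation at `K * b
n`. Take `δ` small, then `K` large. -/

/-! ### Regular variation: tails, normalizing constants, truncated moments -/

lemma pos_of_antitone_of_tendsto_mul {h F : ℝ → ℝ} (hF : Antitone F) (hF0 : ∀ t, 0 ≤ F t)
    (hlim : Tendsto (fun t => h t * F t) atTop (𝓝 1)) (t : ℝ) : 0 < F t := by
  have h1 : ∀ᶠ s in atTop, 0 < h s * F s := hlim.eventually (lt_mem_nhds one_pos)
  obtain ⟨s, hs, hts⟩ := (h1.and (eventually_ge_atTop t)).exists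
  have : F s ≠ 0 := fun h0 => by simp [h0] at hs
  exact ((hF0 s).lt_of_ne this.symm).trans_le (hF hts)

/-- The reciprocal tail inherits regular variation: `F (c t) / F t → c ^ (-α)`. -/
lemma RegularlyVarying.tendsto_tail_ratio {α : ℝ} {h F : ℝ → ℝ} (hh : RegularlyVarying α h)
    (hlim : Tendsto (fun t => h t * F t) atTop (𝓝 1)) {c : ℝ} (hc : 0 < c) :
    Tendsto (fun t => F (c * t) / F t) atTop (𝓝 (c ^ (-α))) := by
  obtain ⟨L, hL, hLc⟩ := hh
  have hct : Tendsto (fun t : ℝ => c * t) atTop atTop := tendsto_id.const_mul_atTop hc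
  -- The ratio of `h * F` at `c * t` and `t` tends to `1`; dividing out the ratio of `h`, which is
  -- `c ^ α` times that of `L`, leaves the ratio of `F`.
  have h1 := (hlim.comp hct).div hlim one_ne_zero
  have h2 := (h1.div (hLc c hc) one_ne_zero).mul_const (c ^ (-α))
  simp only [div_one, one_mul] at h2
  refine h2.congr' ?_
  filter_upwards [eventually_gt_atTop 0, hlim.eventually_ne one_ne_zero,
    (hlim.comp hct).eventually_ne one_ne_zero] with t ht hne hcne
  simp only [Function.comp_apply, Pi.div_apply] at hne hcne ⊢
  have e1 := hL t ht
  have e2 := hL (c * t) (by positivity)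
  have p1 : t ^ α ≠ 0 := (Real.rpow_pos_of_pos ht α).ne'
  have p2 : c ^ α ≠ 0 := (Real.rpow_pos_of_pos hc α).ne'
  rw [Real.mul_rpow hc.le ht.le] at e2
  rw [e1] at hne ⊢
  rw [e2] at hcne ⊢
  rw [Real.rpow_neg hc.le]
  have l1 : L t ≠ 0 := fun h0 => by simp [h0] at hne
  have l2 : L (c * t) ≠ 0 := fun h0 => by simp [h0] at hcne
  have l3 : F t ≠ 0 := fun h0 => by simp [h0] at hne
  field_simp

lemma tendsto_atTop_of_mul_tail {h F : ℝ → ℝ} (hF : Antitone F) (hF0 : ∀ t, 0 ≤ F t)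
    (hlim : Tendsto (fun t => h t * F t) atTop (𝓝 1)) (hFlim : Tendsto F atTop (𝓝 0)) :
    Tendsto h atTop atTop := by
  have hpos := pos_of_antitone_of_tendsto_mul hF hF0 hlim
  have h1 : Tendsto (fun t => (F t)⁻¹) atTop atTop :=
    (tendsto_nhdsWithin_iff.2 ⟨hFlim, Eventually.of_forall hpos⟩).inv_tendsto_nhdsGT_zero
  refine (hlim.pos_mul_atTop one_pos h1).congr fun t => ?_
  field_simp [(hpos t).ne']

lemma nonempty_level_set {h : ℝ → ℝ} (hh : Tendsto h atTop atTop) (n : ℕ) :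
    {t : ℝ | 0 < t ∧ (n : ℝ) ≤ h t}.Nonempty :=
  ((eventually_gt_atTop 0).and (hh.eventually_ge_atTop (n : ℝ))).exists

lemma bddBelow_level_set (h : ℝ → ℝ) (n : ℕ) : BddBelow {t : ℝ | 0 < t ∧ (n : ℝ) ≤ h t} :=
  ⟨0, fun _ ht => ht.1.le⟩

/-- This is where the supremum bound matters: on `(0, T)` it gives `h ≤ C / F T`, so levels `n`
above `C / F T` are reached only from `T` on. -/
lemma tendsto_normalizer {h F : ℝ → ℝ} (hF : Antitone F) (hF0 : ∀ t, 0 ≤ F t)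
    (hlim : Tendsto (fun t => h t * F t) atTop (𝓝 1)) (hFlim : Tendsto F atTop (𝓝 0))
    (hbdd : BddAbove ((fun t : ℝ => h t * F t) '' Set.Ioi 0)) :
    Tendsto (normalizer h) atTop atTop := by
  have hpos := pos_of_antitone_of_tendsto_mul hF hF0 hlim
  have hh := tendsto_atTop_of_mul_tail hF hF0 hlim hFlim
  obtain ⟨C, hC⟩ := hbdd
  refine tendsto_atTop.2 fun T => ?_
  filter_upwards [tendsto_natCast_atTop_atTop.eventually_gt_atTop (C / F T),
    eventually_ge_atTop 1] with n hn hn1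
  refine le_csInf (nonempty_level_set hh n) fun t ht => ?_
  by_contra! hlt
  have h1 : h t * F t ≤ C := hC ⟨t, ht.1, rfl⟩
  rw [div_lt_iff₀ (hpos T)] at hn
  have h2 : (n : ℝ) * F T ≤ h t * F t := by
    have := hF0 T
    have : (0:ℝ) ≤ n := by positivity
    exact mul_le_mul ht.2 (hF hlt.le) (hF0 T) (this.trans ht.2)
  linarith

/-- Along the normalizing constants, `n * F (x * b n) → x ^ (-α)`. -/
lemma tendsto_mul_tail_normalizer {α : ℝ} {h F : ℝ → ℝ} (hh : RegularlyVarying α h)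
    (hF : Antitone F) (hF0 : ∀ t, 0 ≤ F t)
    (hlim : Tendsto (fun t => h t * F t) atTop (𝓝 1)) (hFlim : Tendsto F atTop (𝓝 0))
    (hbdd : BddAbove ((fun t : ℝ => h t * F t) '' Set.Ioi 0)) {x : ℝ} (hx : 0 < x) :
    Tendsto (fun n : ℕ => (n : ℝ) * F (x * normalizer h n)) atTop (𝓝 (x ^ (-α))) := by
  have hpos := pos_of_antitone_of_tendsto_mul hF hF0 hlim
  have hhtop := tendsto_atTop_of_mul_tail hF hF0 hlim hFlim
  have hb := tendsto_normalizer hF hF0 hlim hFlim hbdd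
  have hcont : ContinuousAt (fun c : ℝ => c ^ (-α)) 1 :=
    Real.continuousAt_rpow_const _ _ (Or.inl one_ne_zero)
  have key : Tendsto (fun n : ℕ => (n : ℝ) * F (normalizer h n)) atTop (𝓝 1) := by
    refine tendsto_order.2 ⟨fun y hy => ?_, fun y hy => ?_⟩
    -- As `h` need not be monotone, its value at `b n` is not controlled. Instead take `c < 1`: `c *
    -- b n` lies below the infimum, so `h (c * b n) ≤ n`, and the tail ratio moves `F` back to `b n`
    -- at a cost tending to `1` with `c`.
    · have hc : ∀ᶠ c : ℝ in 𝓝[<] 1, y < 1 / c ^ (-α) ∧ 0 < c ∧ c < 1 := by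
        have : Tendsto (fun c : ℝ => 1 / c ^ (-α)) (𝓝 1) (𝓝 (1 / 1 ^ (-α))) :=
          tendsto_const_nhds.div hcont (by simp)
        rw [Real.one_rpow, div_one] at this
        have h3 : ∀ᶠ c : ℝ in 𝓝[<] 1, c < 1 := eventually_mem_nhdsWithin
        filter_upwards [nhdsWithin_le_nhds (this.eventually (lt_mem_nhds hy)),
          nhdsWithin_le_nhds (lt_mem_nhds one_pos), h3] with c a b d using ⟨a, b, d⟩
      obtain ⟨c, hyc, hc0, hc1⟩ := hc.exists
      have hcb : Tendsto (fun n : ℕ => c * normalizer h n) atTop atTop := hb.const_mul_atTop hc0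
      have h1 := (hlim.comp hcb).div ((hh.tendsto_tail_ratio hlim hc0).comp hb)
        (Real.rpow_pos_of_pos hc0 _).ne'
      filter_upwards [h1.eventually (lt_mem_nhds hyc), hb.eventually_gt_atTop 0] with n hn hbn
      refine hn.trans_le ?_
      simp only [Function.comp_apply, Pi.div_apply]
      have hlt : h (c * normalizer h n) ≤ n := by
        by_contra! hgt
        have : normalizer h n ≤ c * normalizer h n :=
          csInf_le (bddBelow_level_set h n) ⟨by positivity, hgt.le⟩
        nlinarith
      have p1 := hpos (c * normalizer h n)
      have p2 := hpos (normalizer h n)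
      calc _ = h (c * normalizer h n) * F (normalizer h n) := by field_simp
        _ ≤ _ := by gcongr
    -- For `c > 1` some `t` in `[b n, c * b n)` has `n ≤ h t`, whence `n * F (c * b n) ≤ h t * F t`,
    -- eventually at most any `r > 1`.
    · have hc : ∀ᶠ c : ℝ in 𝓝[>] 1, 1 / c ^ (-α) < y ∧ 1 < c := by
        have : Tendsto (fun c : ℝ => 1 / c ^ (-α)) (𝓝 1) (𝓝 (1 / 1 ^ (-α))) :=
          tendsto_const_nhds.div hcont (by simp)
        rw [Real.one_rpow, div_one] at this
        have h3 : ∀ᶠ c : ℝ in 𝓝[>] 1, 1 < c := eventually_mem_nhdsWithin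
        filter_upwards [nhdsWithin_le_nhds (this.eventually (gt_mem_nhds hy)), h3]
          with c a b using ⟨a, b⟩
      obtain ⟨c, hyc, hc1⟩ := hc.exists
      have hc0 : 0 < c := one_pos.trans hc1
      have hpw : 0 < c ^ (-α) := Real.rpow_pos_of_pos hc0 _
      obtain ⟨r, hr1, hry⟩ : ∃ r, 1 < r ∧ r / c ^ (-α) < y := by
        rw [div_lt_iff₀ hpw] at hyc
        obtain ⟨r, h1, h2⟩ := exists_between hyc
        exact ⟨r, h1, by rwa [div_lt_iff₀ hpw]⟩
      have h1 := (tendsto_const_nhds (x := r)).div ((hh.tendsto_tail_ratio hlim hc0).comp hb)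
        hpw.ne'
      obtain ⟨T, hT⟩ := eventually_atTop.1 (hlim.eventually (gt_mem_nhds hr1))
      filter_upwards [h1.eventually (gt_mem_nhds hry), hb.eventually_gt_atTop 0,
        hb.eventually_ge_atTop T] with n hn hbn hbT
      refine lt_of_le_of_lt ?_ hn
      simp only [Function.comp_apply, Pi.div_apply]
      obtain ⟨t, ht, htlt⟩ := exists_lt_of_csInf_lt (nonempty_level_set hhtop n)
        (show normalizer h n < c * normalizer h n by nlinarith)
      have hbt : normalizer h n ≤ t := csInf_le (bddBelow_level_set h n) ht
      have p1 := hpos (c * normalizer h n)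
      have p2 := hpos (normalizer h n)
      have h2 : (n : ℝ) * F (c * normalizer h n) ≤ r := by
        have := hT t (hbT.trans hbt)
        have h3 : (n : ℝ) * F (c * normalizer h n) ≤ h t * F t :=
          mul_le_mul ht.2 (hF htlt.le) p1.le (le_trans (by positivity) ht.2)
        linarith
      rw [div_div_eq_mul_div, le_div_iff₀ p1]
      nlinarith
  have h1 := key.mul ((hh.tendsto_tail_ratio hlim hx).comp hb)
  rw [one_mul] at h1
  refine h1.congr fun n => ?_
  have := hpos (normalizer h n)
  simp only [Function.comp_apply]
  field_simp

/-- A one-sided Karamata estimate for truncated moments, by doubling. -/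
lemma exists_truncated_moment_le {α : ℝ} {h F g : ℝ → ℝ} (hh : RegularlyVarying α h)
    (hF : Antitone F) (hF0 : ∀ t, 0 ≤ F t)
    (hlim : Tendsto (fun t => h t * F t) atTop (𝓝 1)) {p : ℕ} (hp : α < p)
    (hg : Monotone g)
    (hgd : ∀ T, 0 < T → g (2 * T) ≤ g T + (2 * T) ^ p * F T) :
    ∃ C, 0 < C ∧ ∀ᶠ T in atTop, g T ≤ C * (T ^ p * F T) := by
  have hpos := pos_of_antitone_of_tendsto_mul hF hF0 hlim
  have h2 := (hh.tendsto_tail_ratio hlim (c := 2) two_pos).const_mul ((2 : ℝ) ^ p)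
  have hlt : (1 : ℝ) < 2 ^ p * 2 ^ (-α) := by
    rw [← Real.rpow_natCast, ← Real.rpow_add two_pos]
    exact Real.one_lt_rpow (by norm_num) (by linarith)
  -- Because `α < p`, each doubling of `T` beyond `T0` multiplies `T ^ p * F T` by more than `q >
  -- 1`.
  obtain ⟨q, hq1, hq⟩ := exists_between hlt
  obtain ⟨T0, hT0⟩ := eventually_atTop.1
    ((h2.eventually (lt_mem_nhds hq)).and (eventually_ge_atTop 1))
  have hT01 : 1 ≤ T0 := (hT0 T0 le_rfl).2
  -- The first entry handles the block `[T0, 2 * T0]`; the second gives `R + 2 ^ p ≤ R * q`, which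
  -- closes the doubling step.
  set R := max (|g (2 * T0)| / F (2 * T0)) (2 ^ p / (q - 1)) with hR
  have hRpos : 0 < R := lt_max_of_lt_right (div_pos (by positivity) (by linarith))
  have base : ∀ T, T0 ≤ T → T ≤ 2 * T0 → g T ≤ R * (T ^ p * F T) := by
    intro T h1 h2
    have e1 : g T ≤ |g (2 * T0)| := (hg h2).trans (le_abs_self _)
    have e2 : |g (2 * T0)| ≤ R * F (2 * T0) := by
      rw [← div_le_iff₀ (hpos _)]; exact le_max_left _ _
    have e3 : F (2 * T0) ≤ F T := hF h2
    have e4 : (1 : ℝ) ≤ T ^ p := one_le_pow₀ (hT01.trans h1)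
    calc g T ≤ R * F (2 * T0) := e1.trans e2
      _ ≤ R * (1 * F T) := by rw [one_mul]; gcongr
      _ ≤ _ := by have := hpos T; gcongr
  have step : ∀ T, T0 ≤ T → g T ≤ R * (T ^ p * F T) →
      g (2 * T) ≤ R * ((2 * T) ^ p * F (2 * T)) := by
    intro T hT hgT
    have hTpos : 0 < T := by linarith
    have a1 := (hT0 T hT).1
    have pF := hpos T
    rw [← mul_div_assoc, lt_div_iff₀ pF] at a1
    have a2 : 2 ^ p ≤ R * (q - 1) := by
      rw [← div_le_iff₀ (by linarith)]; exact le_max_right _ _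
    have pT : 0 < T ^ p := by positivity
    calc g (2 * T) ≤ R * (T ^ p * F T) + (2 * T) ^ p * F T :=
          (hgd T hTpos).trans (by gcongr)
      _ = (R + 2 ^ p) * (T ^ p * F T) := by rw [mul_pow]; ring
      _ ≤ (R + R * (q - 1)) * (T ^ p * F T) := by gcongr
      _ = R * T ^ p * (q * F T) := by ring
      _ ≤ R * T ^ p * (2 ^ p * F (2 * T)) := by gcongr
      _ = _ := by rw [mul_pow]; ring
  have all : ∀ m : ℕ, ∀ T, T0 ≤ T → T ≤ 2 ^ (m + 1) * T0 → g T ≤ R * (T ^ p * F T) := by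
    intro m
    induction m with
    | zero => intro T h1 h2; exact base T h1 (by simpa using h2)
    | succ m ih =>
      intro T h1 h2
      rcases le_total T (2 * T0) with h3 | h3
      · exact base T h1 h3
      · have := step (T / 2) (by linarith) (ih (T / 2) (by linarith) (by
          rw [pow_succ] at h2; linarith))
        rwa [mul_div_cancel₀ _ two_ne_zero] at this
  refine ⟨R, hRpos, ?_⟩
  filter_upwards [eventually_ge_atTop T0] with T hT
  obtain ⟨m, hm⟩ := pow_unbounded_of_one_lt T (one_lt_two (α := ℝ))
  refine all m T hT ?_
  calc T ≤ 2 ^ m := hm.le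
    _ ≤ 2 ^ (m + 1) * 1 := by rw [mul_one]; exact pow_le_pow_right₀ one_le_two (Nat.le_succ m)
    _ ≤ _ := by gcongr

/-! ### The Fréchet law and convergence in distribution -/

/-- The Fréchet distribution with index `α` exists. -/
lemma exists_frechet {α : ℝ} (hα : 0 < α) : ∃ ν : ProbabilityMeasure ℝ,
    ∀ x : ℝ, 0 < x → cdf (ν : Measure ℝ) x = Real.exp (-x ^ (-α)) := by
  -- If `E` is standard exponential, `E ^ (-1/α)` is Fréchet, since `E ^ (-1/α) ≤ x` means `E ≥ x ^
  -- (-α)`.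
  have : IsProbabilityMeasure (expMeasure 1) := isProbabilityMeasure_expMeasure one_pos
  have hm : Measurable (fun t : ℝ => t ^ (-α⁻¹)) := by fun_prop
  have hp : IsProbabilityMeasure ((expMeasure 1).map (fun t : ℝ => t ^ (-α⁻¹))) :=
    Measure.isProbabilityMeasure_map hm.aemeasurable
  have hIic : ∀ x, (expMeasure 1).real (Set.Iic x) = if 0 ≤ x then 1 - Real.exp (-(1 * x)) else 0 :=
    fun x => by rw [← cdf_eq_real, cdf_expMeasure_eq one_pos]
  have hac : ∀ x, (expMeasure 1) {x} = 0 := by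
    intro x
    have : expMeasure 1 ≪ volume := withDensity_absolutelyContinuous _ _
    exact this (by simp)
  refine ⟨⟨_, hp⟩, fun x hx => ?_⟩
  simp only [ProbabilityMeasure.coe_mk]
  rw [cdf_eq_real, map_measureReal_apply hm measurableSet_Iic]
  have hxp : 0 < x ^ (-α) := Real.rpow_pos_of_pos hx _
  have hae : (fun t : ℝ => t ^ (-α⁻¹)) ⁻¹' Set.Iic x =ᵐ[expMeasure 1]
      ((Set.Iic (x ^ (-α)))ᶜ : Set ℝ) := by
    have h0 : ∀ᵐ t ∂(expMeasure 1), 0 < t := by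
      rw [ae_iff]
      have h1 := hIic 0
      have : {a : ℝ | ¬ 0 < a} = Set.Iic 0 := by ext; simp
      rw [this, ← measureReal_eq_zero_iff, h1]
      simp
    have h1 : ∀ᵐ t ∂(expMeasure 1), t ≠ x ^ (-α) := by
      rw [ae_iff]; simpa using hac (x ^ (-α))
    filter_upwards [h0, h1] with t ht htne
    apply propext
    show t ^ (-α⁻¹) ≤ x ↔ ¬ (t ≤ x ^ (-α))
    rw [not_le]
    have e : x = (x ^ (-α)) ^ (-α⁻¹) := by
      rw [← Real.rpow_mul hx.le]; field_simp; simp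
    have hneg : -α⁻¹ < 0 := by simpa using hα
    constructor
    · intro h
      by_contra! hle
      have hlt := lt_of_le_of_ne hle htne
      have := Real.rpow_lt_rpow_of_neg ht hlt hneg
      rw [← e] at this; linarith
    · intro h
      have := Real.rpow_lt_rpow_of_neg hxp h hneg
      rw [← e] at this; exact this.le
  rw [measureReal_congr hae, probReal_compl_eq_one_sub measurableSet_Iic, hIic, if_pos hxp.le]
  simp

/-- Pointwise convergence of distribution functions on the real line at every point implies
convergence in distribution. -/
lemma tendstoInDistribution_of_tendsto_cdf {Ω : Type*} [MeasurableSpace Ω] {μ : Measure Ω}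
    [IsProbabilityMeasure μ] {ν : Measure ℝ} [IsProbabilityMeasure ν] {X : ℕ → Ω → ℝ}
    (hX : ∀ n, Measurable (X n))
    (hcdf : ∀ x, Tendsto (fun n => μ.real {ω | X n ω ≤ x}) atTop (𝓝 (cdf ν x))) :
    TendstoInDistribution X atTop (id : ℝ → ℝ) (fun _ => μ) ν where
  forall_aemeasurable n := (hX n).aemeasurable
  aemeasurable_limit := aemeasurable_id
  tendsto := by
    have hIoc : ∀ (ρ : Measure ℝ) [IsProbabilityMeasure ρ] (a b : ℝ), a < b →
        ρ.real (Set.Ioc a b) = ρ.real (Set.Iic b) - ρ.real (Set.Iic a) := by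
      intro ρ _ a b hab
      rw [← Set.Iic_sdiff_Iic, measureReal_sdiff (Set.Iic_subset_Iic.2 hab.le) measurableSet_Iic]
    -- Half-open intervals form a π-system containing small neighbourhoods of every point, and their
    -- masses are differences of distribution functions.
    refine (isPiSystem_Ioc (id : ℝ → ℝ) id).tendsto_probabilityMeasure_of_tendsto_of_mem
      ?_ ?_ ?_
    · rintro s ⟨l, u, -, rfl⟩; exact measurableSet_Ioc
    · intro u hu x hx
      obtain ⟨a, b, hxab, hab⟩ := mem_nhds_iff_exists_Ioo_subset.1 (hu.mem_nhds hx)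
      obtain ⟨c, hxc, hcb⟩ := exists_between hxab.2
      exact ⟨Set.Ioc a c, ⟨a, c, hxab.1.trans hxc, rfl⟩, Ioc_mem_nhds hxab.1 hxc,
        fun y hy => hab ⟨hy.1, hy.2.trans_lt hcb⟩⟩
    · rintro s ⟨a, b, hab, rfl⟩
      rw [← NNReal.tendsto_coe]
      simp only [id] at hab ⊢
      have hl := (hcdf b).sub (hcdf a)
      rw [cdf_eq_real, cdf_eq_real, ← hIoc ν a b hab] at hl
      convert hl using 2 with n
      · have : IsProbabilityMeasure (μ.map (X n)) :=
          Measure.isProbabilityMeasure_map (hX n).aemeasurable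
        have := hIoc (μ.map (X n)) a b hab
        rw [map_measureReal_apply (hX n) measurableSet_Iic,
          map_measureReal_apply (hX n) measurableSet_Iic] at this
        exact this
      · simp [measureReal_def]
        rfl

/-! ### Independence and measurability tools -/

/-- If `X` is independent of `Y` and `(X, Y)` is independent of `W`, then `X` is independent of
`(Y, W)`. -/
lemma ProbabilityTheory.IndepFun.assoc_right {Ω E₁ E₂ E₃ : Type*} [MeasurableSpace Ω]
    [MeasurableSpace E₁] [MeasurableSpace E₂] [MeasurableSpace E₃] {μ : Measure Ω}
    [IsProbabilityMeasure μ] {X : Ω → E₁} {Y : Ω → E₂} {W : Ω → E₃} (hX : Measurable X)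
    (hY : Measurable Y) (hW : Measurable W) (hXY : IndepFun X Y μ)
    (hXYW : IndepFun (fun ω => (X ω, Y ω)) W μ) : IndepFun X (fun ω => (Y ω, W ω)) μ := by
  have := Measure.isProbabilityMeasure_map (μ := μ) hX.aemeasurable
  have := Measure.isProbabilityMeasure_map (μ := μ) hY.aemeasurable
  have := Measure.isProbabilityMeasure_map (μ := μ) hW.aemeasurable
  have hYW : IndepFun Y W μ := hXYW.comp measurable_snd measurable_id
  rw [indepFun_iff_map_prod_eq_prod_map_map hX.aemeasurable hY.aemeasurable] at hXY
  rw [indepFun_iff_map_prod_eq_prod_map_map hY.aemeasurable hW.aemeasurable] at hYW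
  rw [indepFun_iff_map_prod_eq_prod_map_map (hX.prodMk hY).aemeasurable hW.aemeasurable,
    hXY] at hXYW
  rw [indepFun_iff_map_prod_eq_prod_map_map hX.aemeasurable (hY.prodMk hW).aemeasurable, hYW]
  have h1 := congrArg (Measure.map (MeasurableEquiv.prodAssoc)) hXYW
  rw [Measure.map_map MeasurableEquiv.prodAssoc.measurable (by fun_prop)] at h1
  have h2 := (measurePreserving_prodAssoc (μ.map X) (μ.map Y) (μ.map W)).map_eq
  rw [h2] at h1
  exact h1

/-- The σ-algebra on `Ω` is left free so that this applies to those generated by part of the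
coefficients. -/
lemma measurable_sum_Icc_random {Ω E : Type*} {m : MeasurableSpace Ω} [MeasurableSpace E]
    [AddCommMonoid E] [MeasurableAdd₂ E] {N : Ω → ℕ}
    (hN : Measurable N) {f : ℕ → Ω → E} (hf : ∀ k, Measurable (f k)) :
    Measurable fun ω => ∑ k ∈ Finset.Icc 1 (N ω), f k ω := by
  have : Measurable fun p : ℕ × Ω => ∑ k ∈ Finset.Icc 1 p.1, f k p.2 :=
    measurable_from_prod_countable_right fun n =>
      Finset.measurable_sum (Finset.Icc 1 n) (f := f) fun k _ => hf k
  exact this.comp (hN.prodMk measurable_id)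

/-- `rcinar Z B n` is measurable for any σ-algebra for which the coefficients up to time `n` are. -/
lemma measurable_rcinar {Ω : Type*} {m : MeasurableSpace Ω} {Z : ℕ → Ω → ℕ} {B : ℕ → ℕ → Ω → ℕ}
    {n : ℕ} (hZ : ∀ i ≤ n, Measurable (Z i)) (hB : ∀ i ≤ n, ∀ k, Measurable (B i k)) :
    Measurable (rcinar Z B n) := by
  induction n with
  | zero => exact measurable_const
  | succ n ih =>
    have h1 := ih (fun i hi => hZ i (hi.trans n.le_succ)) (fun i hi => hB i (hi.trans n.le_succ))
    exact (measurable_sum_Icc_random h1 (hB (n + 1) le_rfl)).add (hZ (n + 1) le_rfl)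

/-! ### Independence structure and uniform moment bounds -/

namespace RCINARCoefficients

variable {Ω : Type*} [mΩ : MeasurableSpace Ω] {μ : Measure Ω}
  {φ : ℕ → Ω → ℝ} {Z : ℕ → Ω → ℕ} {B : ℕ → ℕ → Ω → ℕ}

lemma measurableSet_cylinder (hc : RCINARCoefficients μ φ Z B) (S : Finset (ℕ × ℕ))
    (e : ℕ × ℕ → Bool) : MeasurableSet {ω | ∀ p ∈ S, B p.1 p.2 ω = (e p).toNat} := by
  have : {ω | ∀ p ∈ S, B p.1 p.2 ω = (e p).toNat}
      = ⋂ p ∈ S, B p.1 p.2 ⁻¹' {(e p).toNat} := by ext; simp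
  rw [this]
  exact S.measurableSet_biInter fun p _ => hc.measurable_B _ _ (measurableSet_singleton _)

/-- The conditional law of `B` enters the proof only through this averaged form. -/
lemma measureReal_cylinder [IsProbabilityMeasure μ]
    (hc : RCINARCoefficients μ φ Z B) (S : Finset (ℕ × ℕ))
    (e : ℕ × ℕ → Bool) : μ.real {ω | ∀ p ∈ S, B p.1 p.2 ω = (e p).toNat} =
      ∫ ω, ∏ p ∈ S, (if e p then φ p.1 ω else 1 - φ p.1 ω) ∂μ := by
  have hm : Measurable (fun (ω : Ω) (n : ℕ) => φ n ω) := measurable_pi_lambda _ hc.measurable_φ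
  rw [← integral_congr_ae (hc.condProb_B S e), integral_condExp hm.comap_le,
    integral_indicator_const _ (hc.measurableSet_cylinder S e), smul_eq_mul, mul_one]

/-- A mean equal to one would force `1 - φ 0`, which is nonnegative, to vanish almost surely. This
supplies the contraction factor for moments. -/
lemma integral_φ_lt_one [IsProbabilityMeasure μ]
    (hc : RCINARCoefficients μ φ Z B) (h1 : μ {ω | φ 0 ω = 1} < 1) :
    ∫ ω, φ 0 ω ∂μ < 1 := by
  have hint : Integrable (φ 0) μ := Integrable.of_bound (hc.measurable_φ 0).aestronglyMeasurable 1
    (Eventually.of_forall fun ω => by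
      rw [Real.norm_of_nonneg (hc.φ_mem 0 ω).1]; exact (hc.φ_mem 0 ω).2)
  have hnn : 0 ≤ ∫ ω, (1 - φ 0 ω) ∂μ :=
    integral_nonneg fun ω => sub_nonneg.2 (hc.φ_mem 0 ω).2
  have heq : ∫ ω, (1 - φ 0 ω) ∂μ = 1 - ∫ ω, φ 0 ω ∂μ := by
    rw [integral_sub (integrable_const _) hint]; simp
  rcases hnn.lt_or_eq with h | h
  · linarith
  · exfalso
    rw [eq_comm, integral_eq_zero_iff_of_nonneg (fun ω => sub_nonneg.2 (hc.φ_mem 0 ω).2)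
      ((integrable_const _).sub hint)] at h
    have : μ {ω | φ 0 ω = 1} = 1 := by
      rw [← measure_univ (μ := μ)]
      refine measure_congr ?_
      filter_upwards [h] with ω hω
      simp only [Pi.zero_apply, sub_eq_zero] at hω
      apply propext
      exact ⟨fun _ => trivial, fun _ => hω.symm⟩
    exact h1.ne this

lemma integral_φ (hc : RCINARCoefficients μ φ Z B) (n : ℕ) :
    ∫ ω, φ n ω ∂μ = ∫ ω, φ 0 ω ∂μ := (hc.identDistrib_φ n).integral_eq

lemma lintegral_B [IsProbabilityMeasure μ] (hc : RCINARCoefficients μ φ Z B) (n k : ℕ) :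
    ∫⁻ ω, (B n k ω : ENNReal) ∂μ = ENNReal.ofReal (∫ ω, φ 0 ω ∂μ) := by
  have h1 := hc.measureReal_cylinder {(n, k)} (fun _ => true)
  simp only [Finset.mem_singleton, forall_eq, Bool.toNat_true, Finset.prod_singleton, if_true,
    hc.integral_φ n] at h1
  rw [← h1, ofReal_measureReal]
  have hm : MeasurableSet {ω | B n k ω = 1} := hc.measurable_B n k (measurableSet_singleton 1)
  rw [← lintegral_indicator_one hm]
  refine lintegral_congr fun ω => ?_
  rcases hc.B_mem n k ω with h | h <;> simp [h]

/-- Every thinning variable is independent of those of the earlier rows. -/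
lemma indepFun_B_rows [IsProbabilityMeasure μ] (hc : RCINARCoefficients μ φ Z B) (n k : ℕ) :
    IndepFun (B n k) (fun ω (p : {p : ℕ × ℕ // p.1 < n}) => B p.1.1 p.1.2 ω) μ := by
  refine IndepFun.indepFun_process (hc.measurable_B n k) (fun p => hc.measurable_B _ _) fun I => ?_
  have hI : Measurable (fun ω (p : I) => B p.1.1.1 p.1.1.2 ω) :=
    measurable_pi_lambda _ fun p => hc.measurable_B _ _
  have := Measure.isProbabilityMeasure_map (μ := μ) (hc.measurable_B n k).aemeasurable
  have := Measure.isProbabilityMeasure_map (μ := μ) hI.aemeasurable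
  rw [indepFun_iff_map_prod_eq_prod_map_map (hc.measurable_B n k).aemeasurable hI.aemeasurable]
  refine Measure.ext_of_singleton fun ⟨b, e⟩ => ?_
  rw [← Set.singleton_prod_singleton, Measure.prod_prod,
    Measure.map_apply ((hc.measurable_B n k).prodMk hI) (by measurability),
    Measure.map_apply (hc.measurable_B n k) (measurableSet_singleton _),
    Measure.map_apply hI (measurableSet_singleton _)]
  have hpre : (fun ω => (B n k ω, fun p : I => B p.1.1.1 p.1.1.2 ω)) ⁻¹' ({b} ×ˢ {e})
      = B n k ⁻¹' {b} ∩ (fun ω (p : I) => B p.1.1.1 p.1.1.2 ω) ⁻¹' {e} := rfl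
  rw [hpre]
  by_cases hb : b = 0 ∨ b = 1
  swap
  · have : B n k ⁻¹' {b} = ∅ := by
      ext ω
      rcases hc.B_mem n k ω with h | h <;> simp [h] <;> omega
    simp [this]
  by_cases he : ∀ p : I, e p = 0 ∨ e p = 1
  swap
  · have : (fun ω (p : I) => B p.1.1.1 p.1.1.2 ω) ⁻¹' {e} = ∅ := by
      push Not at he
      obtain ⟨p, h0, h1⟩ := he
      ext ω
      simp only [Set.mem_preimage, Set.mem_singleton_iff, Set.mem_empty_iff_false, iff_false]
      intro h
      have := congrFun h p
      rcases hc.B_mem p.1.1.1 p.1.1.2 ω with h | h <;> simp_all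
    simp [this]
  classical
  -- One pattern encodes both `e` on `I` and `b` at `(n, k)`: that site is in row `n`, outside `I`,
  -- so it receives the default value `b`.
  let e' : ℕ × ℕ → Bool := fun q =>
    if h : ∃ hq : q.1 < n, (⟨q, hq⟩ : {p : ℕ × ℕ // p.1 < n}) ∈ I then
      decide (e ⟨⟨q, h.1⟩, h.2⟩ = 1) else decide (b = 1)
  let S : Finset (ℕ × ℕ) := I.map ⟨Subtype.val, Subtype.val_injective⟩
  have hS : ∀ q ∈ S, q.1 < n := by
    intro q hq
    obtain ⟨p, -, rfl⟩ := Finset.mem_map.1 hq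
    exact p.2
  have hnk : (n, k) ∉ S := fun h => lt_irrefl _ (hS _ h)
  have he'b : (e' (n, k)).toNat = b := by
    have : e' (n, k) = decide (b = 1) := by simp [e']
    rw [this]; rcases hb with rfl | rfl <;> simp
  have he'I : ∀ p : I, (e' p.1.1).toNat = e p := by
    intro p
    have : e' p.1.1 = decide (e p = 1) := by
      simp only [e']
      rw [dif_pos ⟨p.1.2, p.2⟩]
    rw [this]; rcases he p with h | h <;> simp [h]
  have hset2 : (fun ω (p : I) => B p.1.1.1 p.1.1.2 ω) ⁻¹' {e}
      = {ω | ∀ p ∈ S, B p.1 p.2 ω = (e' p).toNat} := by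
    ext ω
    simp only [Set.mem_preimage, Set.mem_singleton_iff, Set.mem_ofPred_eq, S, Finset.mem_map,
      Function.Embedding.coeFn_mk]
    constructor
    · rintro h q ⟨p, hp, rfl⟩
      rw [he'I ⟨p, hp⟩, ← h]
    · intro h
      funext p
      rw [← he'I p]
      exact h _ ⟨p.1, p.2, rfl⟩
  have hset1 : B n k ⁻¹' {b} = {ω | ∀ p ∈ ({(n, k)} : Finset (ℕ × ℕ)),
      B p.1 p.2 ω = (e' p).toNat} := by
    ext ω; simp [he'b]
  have hset : B n k ⁻¹' {b} ∩ (fun ω (p : I) => B p.1.1.1 p.1.1.2 ω) ⁻¹' {e}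
      = {ω | ∀ p ∈ insert (n, k) S, B p.1 p.2 ω = (e' p).toNat} := by
    rw [hset1, hset2]
    ext ω
    simp
  -- The site factor uses only `φ n`, the others only `φ i` with `i < n`, so the cylinder integral
  -- factors.
  have hind : IndepFun (fun ω => if e' (n, k) then φ n ω else 1 - φ n ω)
      (fun ω => ∏ p ∈ S, (if e' p then φ p.1 ω else 1 - φ p.1 ω)) μ := by
    have h0 := hc.indep_φ.indepFun_finset {n} (Finset.range n) (by simp) hc.measurable_φ
    have hn : Measurable fun x : ({n} : Finset ℕ) → ℝ => x ⟨n, Finset.mem_singleton_self n⟩ :=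
      measurable_pi_apply _
    have := h0.comp
      (φ := fun x : ({n} : Finset ℕ) → ℝ =>
        if e' (n, k) then x ⟨n, Finset.mem_singleton_self n⟩
          else 1 - x ⟨n, Finset.mem_singleton_self n⟩)
      (ψ := fun x : Finset.range n → ℝ => ∏ p ∈ S.attach,
        if e' p.1 then x ⟨p.1.1, by simpa using hS _ p.2⟩ else
        1 - x ⟨p.1.1, by simpa using hS _ p.2⟩)
      (by split_ifs; exacts [hn, hn.const_sub 1])
      (Finset.measurable_prod _ fun p _ => by split_ifs <;> fun_prop)
    convert this using 1
    exacts [rfl, funext fun ω =>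
      (Finset.prod_attach S fun p => if e' p then φ p.1 ω else 1 - φ p.1 ω).symm]
  rw [← ofReal_measureReal, ← ofReal_measureReal (s := B n k ⁻¹' {b}),
    ← ofReal_measureReal (s := (fun ω (p : I) => B p.1.1.1 p.1.1.2 ω) ⁻¹' {e}),
    ← ENNReal.ofReal_mul measureReal_nonneg, hset, hset1, hset2, hc.measureReal_cylinder,
    hc.measureReal_cylinder, hc.measureReal_cylinder]
  congr 1
  simp only [Finset.prod_insert hnk, Finset.prod_singleton]
  have hφ := hc.measurable_φ
  refine hind.integral_fun_mul_eq_mul_integral ?_ ?_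
  · exact Measurable.aestronglyMeasurable (by split_ifs <;> fun_prop)
  · exact Measurable.aestronglyMeasurable
      (Finset.measurable_prod _ fun p _ => by split_ifs <;> fun_prop)

/-- A thinning variable is independent of the earlier states of the process, driven by any
innovations that are functions of `Z`. -/
lemma indepFun_B_rcinar [IsProbabilityMeasure μ]
    (hc : RCINARCoefficients μ φ Z B) (f : ℕ → ℕ) {n m : ℕ} (hmn : m < n)
    (k : ℕ) : IndepFun (B n k) (rcinar (fun i ω => f (Z i ω)) B m) μ := by
  have hY : Measurable (fun ω (p : {p : ℕ × ℕ // p.1 < n}) => B p.1.1 p.1.2 ω) :=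
    measurable_pi_lambda _ fun p => hc.measurable_B _ _
  have hZ : Measurable (fun (ω : Ω) (n : ℕ) => Z n ω) := measurable_pi_lambda _ hc.measurable_Z
  have h1 := hc.indep_φB_Z.comp (φ := fun x : (ℕ → ℝ) × (ℕ → ℕ → ℕ) =>
    (x.2 n k, fun p : {p : ℕ × ℕ // p.1 < n} => x.2 p.1.1 p.1.2)) (ψ := id)
    (by fun_prop) measurable_id
  -- `B n k` is independent of the earlier rows together with all of `Z`, and the earlier states are
  -- functions of these.
  have h2 := (hc.indepFun_B_rows n k).assoc_right (hc.measurable_B n k) hY hZ h1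
  rw [IndepFun_iff_Indep] at h2 ⊢
  refine indep_of_indep_of_le_right h2 (Measurable.comap_le ?_)
  set m' := MeasurableSpace.comap (fun ω => ((fun p : {p : ℕ × ℕ // p.1 < n} => B p.1.1 p.1.2 ω),
    fun i : ℕ => Z i ω)) inferInstance with hm'
  have hbase := comap_measurable (m := inferInstance)
    (fun ω => ((fun p : {p : ℕ × ℕ // p.1 < n} => B p.1.1 p.1.2 ω), fun i : ℕ => Z i ω))
  refine measurable_rcinar (m := m') (fun i _ => ?_) (fun i hi j => ?_)
  · exact (Measurable.of_discrete (f := f)).comp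
      (((measurable_pi_apply i).comp measurable_snd).comp hbase)
  · exact ((measurable_pi_apply (⟨(i, j), hi.trans_lt hmn⟩ : {p : ℕ × ℕ // p.1 < n})).comp
      measurable_fst).comp hbase

/-- An innovation is independent of the earlier states of the process. -/
lemma indepFun_Z_rcinar [IsProbabilityMeasure μ]
    (hc : RCINARCoefficients μ φ Z B) {n m : ℕ} (hmn : m < n) :
    IndepFun (Z n) (rcinar Z B m) μ := by
  have hY : Measurable (fun ω (i : Finset.range n) => Z i ω) :=
    measurable_pi_lambda _ fun i => hc.measurable_Z _
  have hB : Measurable (fun (ω : Ω) (n k : ℕ) => B n k ω) :=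
    measurable_pi_lambda _ fun n => measurable_pi_lambda _ fun k => hc.measurable_B n k
  have h0 : IndepFun (Z n) (fun ω (i : Finset.range n) => Z i ω) μ := by
    have h0 := hc.indep_Z.indepFun_finset {n} (Finset.range n) (by simp) hc.measurable_Z
    exact h0.comp (φ := fun x : ({n} : Finset ℕ) → ℕ => x ⟨n, by simp⟩) (ψ := id)
      (by fun_prop) measurable_id
  have h1 := hc.indep_φB_Z.symm.comp
    (φ := fun x : ℕ → ℕ => (x n, fun i : Finset.range n => x i))
    (ψ := Prod.snd) (by fun_prop) measurable_snd
  have h2 := h0.assoc_right (hc.measurable_Z n) hY hB h1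
  rw [IndepFun_iff_Indep] at h2 ⊢
  refine indep_of_indep_of_le_right h2 (Measurable.comap_le ?_)
  set m' := MeasurableSpace.comap (fun ω => ((fun i : Finset.range n => Z i ω),
    fun n k : ℕ => B n k ω)) inferInstance with hm'
  have hbase := comap_measurable (m := inferInstance)
    (fun ω => ((fun i : Finset.range n => Z i ω), fun n k : ℕ => B n k ω))
  refine measurable_rcinar (m := m') (fun i hi => ?_) (fun i hi j => ?_)
  · exact ((measurable_pi_apply (⟨i, by simpa using hi.trans_lt hmn⟩ : Finset.range n)).comp
      measurable_fst).comp hbase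
  · exact ((measurable_pi_apply j).comp ((measurable_pi_apply i).comp measurable_snd)).comp hbase

/-- Thinning multiplies the `p`-th moment of a state by at most the mean thinning probability. -/
lemma lintegral_thinning_pow_le [IsProbabilityMeasure μ]
    (hc : RCINARCoefficients μ φ Z B) (f : ℕ → ℕ) (n q : ℕ) :
    ∫⁻ ω, ((∑ k ∈ Finset.Icc 1 (rcinar (fun i ω => f (Z i ω)) B n ω), B (n + 1) k ω : ℕ) :
        ENNReal) ^ (q + 1) ∂μ ≤
      ENNReal.ofReal (∫ ω, φ 0 ω ∂μ) *
        ∫⁻ ω, (rcinar (fun i ω => f (Z i ω)) B n ω : ENNReal) ^ (q + 1) ∂μ := by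
  set N := rcinar (fun i ω => f (Z i ω)) B n with hN
  have hNm : Measurable N := measurable_rcinar
    (fun i _ => Measurable.of_discrete.comp (hc.measurable_Z i)) (fun i _ k => hc.measurable_B i k)
  -- These weights turn the sum of random length into a series whose terms are products of a
  -- function of `N` and an independent `B (n + 1) k`.
  set ψ : ℕ → ℕ → ENNReal := fun k m => if k ∈ Finset.Icc 1 m then (m : ENNReal) ^ q else 0
  have hψ : ∀ k, Measurable (ψ k) := fun k => Measurable.of_discrete
  have hsum : ∀ (m : ℕ) (c : ℕ → ENNReal),
      ∑' k, ψ k m * c k = (m : ENNReal) ^ q * ∑ k ∈ Finset.Icc 1 m, c k := by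
    intro m c
    rw [tsum_eq_sum (s := Finset.Icc 1 m) (fun k hk => by simp only [ψ]; rw [if_neg hk, zero_mul]),
      Finset.mul_sum]
    exact Finset.sum_congr rfl fun k hk => by simp only [ψ]; rw [if_pos hk]
  -- A sum of `N` zero-one terms is at most `N`, so its power `q + 1` is at most `N ^ q` times the
  -- sum itself.
  calc _ ≤ ∫⁻ ω, ∑' k, ψ k (N ω) * (B (n + 1) k ω : ENNReal) ∂μ := by
        refine lintegral_mono fun ω => ?_
        rw [hsum, pow_succ, Nat.cast_sum]
        gcongr
        calc ∑ k ∈ Finset.Icc 1 (N ω), (B (n + 1) k ω : ENNReal)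
            ≤ ∑ k ∈ Finset.Icc 1 (N ω), 1 := Finset.sum_le_sum fun k _ => by
              rcases hc.B_mem (n + 1) k ω with h | h <;> simp [h]
          _ = N ω := by simp
    _ = ∑' k, ∫⁻ ω, ψ k (N ω) * (B (n + 1) k ω : ENNReal) ∂μ := by
        refine lintegral_tsum fun k => ?_
        exact (((hψ k).comp hNm).mul
          (Measurable.of_discrete.comp (hc.measurable_B (n + 1) k))).aemeasurable
    _ = ∑' k, (∫⁻ ω, ψ k (N ω) ∂μ) * ENNReal.ofReal (∫ ω, φ 0 ω ∂μ) := by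
        refine tsum_congr fun k => ?_
        rw [← hc.lintegral_B (n + 1) k]
        have hi := (hc.indepFun_B_rcinar f n.lt_succ_self k).symm.comp (hψ k)
          (Measurable.of_discrete (f := fun j : ℕ => (j : ENNReal)))
        exact lintegral_mul_eq_lintegral_mul_lintegral_of_indepFun ((hψ k).comp hNm)
          (Measurable.of_discrete.comp (hc.measurable_B (n + 1) k)) hi
    _ = ENNReal.ofReal (∫ ω, φ 0 ω ∂μ) * ∫⁻ ω, ∑' k, ψ k (N ω) ∂μ := by
        have := lintegral_tsum (μ := μ) (f := fun k ω => ψ k (N ω))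
          fun k => ((hψ k).comp hNm).aemeasurable
        rw [ENNReal.tsum_mul_right, mul_comm, this]
    _ = _ := by
        congr 1
        refine lintegral_congr fun ω => ?_
        have := hsum (N ω) (fun _ => 1)
        simp only [mul_one] at this
        rw [this, pow_succ]
        simp

/-- Uniform moment bound for the process: the moments of the states are at most a constant times
those of the innovations. -/
lemma exists_lintegral_rcinar_pow_le [IsProbabilityMeasure μ] (hc : RCINARCoefficients μ φ Z B)
    (h1 : μ {ω | φ 0 ω = 1} < 1) {p : ℕ} (hp : 1 ≤ p) :
    ∃ C : ENNReal, C ≠ ⊤ ∧ ∀ (f : ℕ → ℕ) (n : ℕ),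
      ∫⁻ ω, (rcinar (fun i ω => f (Z i ω)) B n ω : ENNReal) ^ p ∂μ ≤
        C * ∫⁻ ω, (f (Z 0 ω) : ENNReal) ^ p ∂μ := by
  obtain ⟨q, rfl⟩ : ∃ q, p = q + 1 := ⟨p - 1, by omega⟩
  set r : ℝ := ((q + 1 : ℕ) : ℝ) with hr
  have hr1 : 1 ≤ r := by simp [hr]
  have hr0 : 0 < r := by linarith
  set ρ := ENNReal.ofReal (∫ ω, φ 0 ω ∂μ) with hρ
  have hρ1 : ρ < 1 := by
    rw [hρ, ENNReal.ofReal_lt_one]; exact hc.integral_φ_lt_one h1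
  set θ := ρ ^ (1 / r) with hθ
  have hθ1 : θ < 1 := ENNReal.rpow_lt_one hρ1 (by positivity)
  have hD : (1 - θ)⁻¹ ≠ ⊤ := ENNReal.inv_ne_top.2 (tsub_pos_of_lt hθ1).ne'
  refine ⟨((1 - θ)⁻¹) ^ r, ENNReal.rpow_ne_top_of_nonneg hr0.le hD, fun f n => ?_⟩
  set I := ∫⁻ ω, (f (Z 0 ω) : ENNReal) ^ (q + 1) ∂μ with hI
  set a : ℕ → ENNReal := fun n =>
    ∫⁻ ω, (rcinar (fun i ω => f (Z i ω)) B n ω : ENNReal) ^ (q + 1) ∂μ with ha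
  have hfZ : ∀ m, Measurable (fun ω => f (Z m ω)) :=
    fun m => Measurable.of_discrete.comp (hc.measurable_Z m)
  have hcast : Measurable (fun j : ℕ => (j : ENNReal)) := Measurable.of_discrete
  have hIm : ∀ m, ∫⁻ ω, (f (Z m ω) : ENNReal) ^ (q + 1) ∂μ = I := fun m =>
    ((hc.identDistrib_Z m).comp
      (u := fun j : ℕ => (f j : ENNReal) ^ (q + 1)) Measurable.of_discrete).lintegral_eq
  -- Minkowski's inequality in `L^r`; thinning contracts the norm by `θ`.
  have hstep : ∀ m, a (m + 1) ^ (1 / r) ≤ θ * a m ^ (1 / r) + I ^ (1 / r) := by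
    intro m
    have hN : Measurable (rcinar (fun i ω => f (Z i ω)) B m) := measurable_rcinar
      (fun i _ => hfZ i) (fun i _ k => hc.measurable_B i k)
    have hT := measurable_sum_Icc_random hN (fun k => hc.measurable_B (m + 1) k)
    have := ENNReal.lintegral_Lp_add_le (μ := μ) (hcast.comp hT).aemeasurable
      (hcast.comp (hfZ (m + 1))).aemeasurable hr1
    simp only [hr, ENNReal.rpow_natCast, Pi.add_apply, Function.comp_apply] at this
    rw [hIm (m + 1)] at this
    calc a (m + 1) ^ (1 / r) ≤ _ := by
          refine le_trans (le_of_eq ?_) this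
          simp only [ha, rcinar, Nat.cast_add, hr]
      _ ≤ (ρ * a m) ^ (1 / r) + I ^ (1 / r) := by
          gcongr
          exact hc.lintegral_thinning_pow_le f m q
      _ = _ := by rw [ENNReal.mul_rpow_of_nonneg _ _ (by positivity)]
  -- The constant is the fixed point of `x ↦ 1 + θ * x`, so the induction preserves it.
  have hgeo : (1 - θ)⁻¹ = 1 + θ * (1 - θ)⁻¹ := by
    have h := ENNReal.mul_inv_cancel (tsub_pos_of_lt hθ1).ne' (by finiteness)
    calc (1 - θ)⁻¹ = (1 - θ + θ) * (1 - θ)⁻¹ := by rw [tsub_add_cancel_of_le hθ1.le, one_mul]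
      _ = _ := by rw [add_mul, h]
  have hbound : ∀ m, a m ^ (1 / r) ≤ (1 - θ)⁻¹ * I ^ (1 / r) := by
    intro m
    induction m with
    | zero =>
      have : a 0 = 0 := by simp [ha, rcinar]
      rw [this, ENNReal.zero_rpow_of_pos (by positivity)]
      exact zero_le
    | succ m ih =>
      calc a (m + 1) ^ (1 / r) ≤ θ * ((1 - θ)⁻¹ * I ^ (1 / r)) + I ^ (1 / r) :=
            (hstep m).trans (by gcongr)
        _ = (1 + θ * (1 - θ)⁻¹) * I ^ (1 / r) := by ring
        _ = _ := by rw [← hgeo]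
  have := ENNReal.rpow_le_rpow (hbound n) hr0.le
  rwa [ENNReal.mul_rpow_of_nonneg _ _ hr0.le, ← ENNReal.rpow_mul, ← ENNReal.rpow_mul,
    one_div_mul_cancel hr0.ne', ENNReal.rpow_one, ENNReal.rpow_one] at this

end RCINARCoefficients

/-! ### Truncated innovations and pathwise comparison -/

/-- Truncation of a natural number at the real level `c`. -/
noncomputable def natTrunc (c : ℝ) (m : ℕ) : ℕ := if (m : ℝ) ≤ c then m else 0

lemma natTrunc_of_le {c : ℝ} {m : ℕ} (h : (m : ℝ) ≤ c) : natTrunc c m = m := if_pos h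

lemma natTrunc_of_lt {c : ℝ} {m : ℕ} (h : c < m) : natTrunc c m = 0 := if_neg h.not_ge

lemma natTrunc_le_self (c : ℝ) (m : ℕ) : natTrunc c m ≤ m := by
  unfold natTrunc; split_ifs <;> simp

lemma natTrunc_mono (m : ℕ) : Monotone fun c => natTrunc c m := by
  intro c d hcd
  rcases le_or_gt (m : ℝ) c with h | h
  · simp [natTrunc_of_le h, natTrunc_of_le (h.trans hcd)]
  · simp [natTrunc_of_lt h]

lemma natTrunc_le_ofReal (c : ℝ) (m : ℕ) : (natTrunc c m : ENNReal) ≤ ENNReal.ofReal c := by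
  rcases le_or_gt (m : ℝ) c with h | h
  · rw [natTrunc_of_le h, ← ENNReal.ofReal_natCast]; exact ENNReal.ofReal_le_ofReal h
  · simp [natTrunc_of_lt h]

section Pathwise

variable {Ω : Type*} {Z Z' : ℕ → Ω → ℕ} {B : ℕ → ℕ → Ω → ℕ} {ω : Ω}

lemma rcinar_mono (h : ∀ n, Z' n ω ≤ Z n ω) (n : ℕ) : rcinar Z' B n ω ≤ rcinar Z B n ω := by
  induction n with
  | zero => exact le_rfl
  | succ n ih =>
    exact add_le_add (Finset.sum_le_sum_of_subset (Finset.Icc_subset_Icc_right ih)) (h _)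

lemma rcinar_congr {n : ℕ} (h : ∀ i ∈ Finset.Icc 1 n, Z i ω = Z' i ω) :
    rcinar Z B n ω = rcinar Z' B n ω := by
  induction n with
  | zero => rfl
  | succ n ih =>
    have h1 := ih fun i hi => h i (Finset.Icc_subset_Icc_right n.le_succ hi)
    simp only [rcinar, h1, h (n + 1) (by simp)]

/-- Each of the `x - s` extra individuals leaves at most one survivor; hence common thinning does
not widen the gap between two states. -/
lemma sum_Icc_le_add_sub {b : ℕ → ℕ} (hb : ∀ k, b k ≤ 1) {s x : ℕ} (hsx : s ≤ x) :
    ∑ k ∈ Finset.Icc 1 x, b k ≤ ∑ k ∈ Finset.Icc 1 s, b k + (x - s) := by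
  induction x, hsx using Nat.le_induction with
  | base => simp
  | succ x hx ih =>
    rw [Finset.sum_Icc_succ_top (by omega)]
    have := hb (x + 1)
    omega

lemma le_runningMax {n k : ℕ} (hk : k ∈ Finset.Icc 1 n) : Z k ω ≤ runningMax Z n ω :=
  Finset.le_sup (f := fun k => Z k ω) hk

lemma runningMax_mono_right {m n : ℕ} (h : m ≤ n) : runningMax Z m ω ≤ runningMax Z n ω :=
  Finset.sup_mono (Finset.Icc_subset_Icc_right h)

lemma runningMax_le_iff {n : ℕ} {r : ℝ} (hr : 0 ≤ r) :
    (runningMax Z n ω : ℝ) ≤ r ↔ ∀ k ∈ Finset.Icc 1 n, (Z k ω : ℝ) ≤ r := by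
  simp only [← Nat.le_floor_iff hr, runningMax, Finset.sup_le_iff]

lemma runningMax_le_runningMax_rcinar (n : ℕ) :
    runningMax Z n ω ≤ runningMax (rcinar Z B) n ω := by
  refine Finset.sup_mono_fun fun k hk => ?_
  obtain ⟨j, rfl⟩ : ∃ j, k = j + 1 := ⟨k - 1, by have := (Finset.mem_Icc.1 hk).1; omega⟩
  exact Nat.le_add_left _ _

/-- If the state is at most `e` whenever an innovation exceeds `c`, the process stays below the
process driven by the truncated innovations, plus `e`, plus the maximal innovation. -/
lemma rcinar_le_rcinar_natTrunc_add (hB : ∀ n k, B n k ω ≤ 1) {c e : ℝ} (he : 0 ≤ e) {n : ℕ}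
    (hj : ∀ j < n, c < Z (j + 1) ω → (rcinar Z B j ω : ℝ) ≤ e) {k : ℕ} (hk : k ≤ n) :
    (rcinar Z B k ω : ℝ) ≤
      rcinar (fun i ω => natTrunc c (Z i ω)) B k ω + e + runningMax Z k ω := by
  induction k with
  | zero => simp only [rcinar, Nat.cast_zero]; positivity
  | succ k ih =>
    have ihk := ih (by omega)
    set S := rcinar (fun i ω => natTrunc c (Z i ω)) B with hS
    have hSX : S k ω ≤ rcinar Z B k ω := rcinar_mono (fun n => natTrunc_le_self _ _) k
    have hm : (runningMax Z k ω : ℝ) ≤ runningMax Z (k + 1) ω := by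
      exact_mod_cast runningMax_mono_right (Z := Z) (ω := ω) k.le_succ
    -- A small innovation enters both processes, so the gap `X - S` does not grow. A large one meets
    -- a state at most `e`, giving a fresh bound `e + Z (k + 1)` independent of the past gap; thus
    -- errors do not accumulate.
    rcases le_or_gt (Z (k + 1) ω : ℝ) c with hZ | hZ
    · have h1 := sum_Icc_le_add_sub (hB (k + 1)) hSX
      have h2 : rcinar Z B (k + 1) ω + S k ω ≤ S (k + 1) ω + rcinar Z B k ω := by
        simp only [hS, rcinar, natTrunc_of_le hZ] at h1 hSX ⊢
        omega
      have h3 : (rcinar Z B (k + 1) ω : ℝ) + S k ω ≤ S (k + 1) ω + rcinar Z B k ω := by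
        exact_mod_cast h2
      linarith
    · have h1 := sum_Icc_le_add_sub (hB (k + 1)) (Nat.zero_le (rcinar Z B k ω))
      have h2 : rcinar Z B (k + 1) ω ≤ rcinar Z B k ω + Z (k + 1) ω := by
        simp only [rcinar]
        simpa using h1
      have h3 : (rcinar Z B (k + 1) ω : ℝ) ≤ rcinar Z B k ω + Z (k + 1) ω := by exact_mod_cast h2
      have h4 := hj k (by omega) hZ
      have h5 : (Z (k + 1) ω : ℝ) ≤ runningMax Z (k + 1) ω := by
        exact_mod_cast le_runningMax (Z := Z) (ω := ω) (Finset.mem_Icc.2 ⟨by omega, le_rfl⟩)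
      have h6 : (0 : ℝ) ≤ S (k + 1) ω := by positivity
      linarith

end Pathwise

lemma measurable_runningMax {Ω : Type*} [MeasurableSpace Ω] {Y : ℕ → Ω → ℕ}
    (hY : ∀ n, Measurable (Y n)) (n : ℕ) : Measurable (runningMax Y n) := by
  unfold runningMax
  induction Finset.Icc 1 n using Finset.induction with
  | empty => exact measurable_const
  | insert a s _ ih => simp only [Finset.sup_insert]; exact (hY a).sup ih

/-! ### Tails and truncated moments of integer variables -/

/-- The tail function of a random variable with values in `ℕ`. -/
noncomputable def natTail {Ω : Type*} [MeasurableSpace Ω] (μ : Measure Ω) (Y : Ω → ℕ) (t : ℝ) : ℝ :=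
  μ.real {ω | t < (Y ω : ℝ)}

/-- The `p`-th moment of a random variable with values in `ℕ`, truncated at level `c`. -/
noncomputable def truncMoment {Ω : Type*} [MeasurableSpace Ω] (μ : Measure Ω) (Y : Ω → ℕ) (p : ℕ)
    (c : ℝ) : ℝ :=
  (∫⁻ ω, (natTrunc c (Y ω) : ENNReal) ^ p ∂μ).toReal

section Tail

variable {Ω : Type*} [MeasurableSpace Ω] {μ : Measure Ω} {Y : Ω → ℕ}

lemma measurableSet_natTail (hY : Measurable Y) (t : ℝ) : MeasurableSet {ω | t < (Y ω : ℝ)} :=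
  measurableSet_lt measurable_const (Measurable.of_discrete.comp hY)

lemma natTail_antitone [IsProbabilityMeasure μ] : Antitone (natTail μ Y) := fun _ _ h =>
  measureReal_mono fun _ hω => lt_of_le_of_lt h hω

lemma natTail_nonneg (t : ℝ) : 0 ≤ natTail μ Y t := measureReal_nonneg

lemma tendsto_natTail [IsProbabilityMeasure μ]
    (hY : Measurable Y) : Tendsto (natTail μ Y) atTop (𝓝 0) := by
  have hm : Measurable fun ω => (Y ω : ℝ) := Measurable.of_discrete.comp hY
  have := Measure.isProbabilityMeasure_map (μ := μ) hm.aemeasurable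
  have h := (tendsto_cdf_atTop (μ.map fun ω => (Y ω : ℝ))).const_sub 1
  rw [sub_self] at h
  refine h.congr fun t => ?_
  rw [cdf_eq_real, map_measureReal_apply hm measurableSet_Iic,
    ← probReal_compl_eq_one_sub (hm measurableSet_Iic), natTail]
  congr 1
  ext ω
  simp

lemma lintegral_natTrunc_lt_top [IsProbabilityMeasure μ] (p : ℕ) (c : ℝ) :
    ∫⁻ ω, (natTrunc c (Y ω) : ENNReal) ^ p ∂μ < ⊤ :=
  calc _ ≤ ∫⁻ _, ENNReal.ofReal c ^ p ∂μ :=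
        lintegral_mono fun ω => pow_le_pow_left' (natTrunc_le_ofReal c _) p
    _ < ⊤ := by simp

lemma truncMoment_mono [IsProbabilityMeasure μ] (p : ℕ) : Monotone (truncMoment μ Y p) := fun _ d h =>
  ENNReal.toReal_mono (lintegral_natTrunc_lt_top p d).ne <| lintegral_mono fun ω =>
    pow_le_pow_left' (Nat.cast_le.2 (natTrunc_mono (Y ω) h)) p

/-- Doubling the level adds only values in `(T, 2 * T]`. This is the recursion required by
`exists_truncated_moment_le`. -/
lemma truncMoment_two_mul_le [IsProbabilityMeasure μ]
    (hY : Measurable Y) (p : ℕ) {T : ℝ} (hT : 0 < T) :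
    truncMoment μ Y p (2 * T) ≤ truncMoment μ Y p T + (2 * T) ^ p * natTail μ Y T := by
  have hle : ∫⁻ ω, (natTrunc (2 * T) (Y ω) : ENNReal) ^ p ∂μ ≤
      ∫⁻ ω, (natTrunc T (Y ω) : ENNReal) ^ p ∂μ
        + ENNReal.ofReal (2 * T) ^ p * μ {ω | T < (Y ω : ℝ)} := by
    have hm : Measurable fun ω => (natTrunc T (Y ω) : ENNReal) ^ p :=
      (Measurable.of_discrete (f := fun m : ℕ => (natTrunc T m : ENNReal) ^ p)).comp hY
    rw [← lintegral_indicator_const (measurableSet_natTail hY T), ← lintegral_add_left hm]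
    refine lintegral_mono fun ω => ?_
    rcases le_or_gt (Y ω : ℝ) T with h | h
    · simp only [natTrunc_of_le h, natTrunc_of_le (show (Y ω : ℝ) ≤ 2 * T by linarith)]
      exact le_self_add
    · simp only [natTrunc_of_lt h]
      rw [Set.indicator_of_mem (show ω ∈ {ω | T < (Y ω : ℝ)} from h)]
      exact (pow_le_pow_left' (natTrunc_le_ofReal _ _) p).trans le_add_self
  have := ENNReal.toReal_mono (by
    have := lintegral_natTrunc_lt_top (μ := μ) (Y := Y) p T
    finiteness) hle
  rw [ENNReal.toReal_add (lintegral_natTrunc_lt_top p T).ne (by finiteness), ENNReal.toReal_mul,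
    ENNReal.toReal_pow, ENNReal.toReal_ofReal (by linarith)] at this
  exact this

end Tail

/-! ### Probability bounds for the process and its maximum -/

namespace RCINARCoefficients

variable {Ω : Type*} [MeasurableSpace Ω] {μ : Measure Ω}
  {φ : ℕ → Ω → ℝ} {Z : ℕ → Ω → ℕ} {B : ℕ → ℕ → Ω → ℕ}

lemma natTail_eq (hc : RCINARCoefficients μ φ Z B) (n : ℕ) : natTail μ (Z n) = natTail μ (Z 0) := by
  funext t
  exact congrArg ENNReal.toReal ((hc.identDistrib_Z n).measure_mem_eq
    (s := {m : ℕ | t < (m : ℝ)}) (MeasurableSet.of_discrete))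

lemma measurable_rcinar (hc : RCINARCoefficients μ φ Z B) (n : ℕ) : Measurable (rcinar Z B n) :=
  _root_.measurable_rcinar (fun i _ => hc.measurable_Z i) (fun i _ k => hc.measurable_B i k)

/-- Markov's inequality for the process driven by truncated innovations. -/
lemma exists_measureReal_rcinar_natTrunc_le [IsProbabilityMeasure μ]
    (hc : RCINARCoefficients μ φ Z B)
    (h1 : μ {ω | φ 0 ω = 1} < 1) {p : ℕ} (hp : 1 ≤ p) :
    ∃ C : ℝ, 0 ≤ C ∧ ∀ (c e : ℝ) (k : ℕ), 0 < e →
      μ.real {ω | e < (rcinar (fun i ω => natTrunc c (Z i ω)) B k ω : ℝ)} ≤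
        C * truncMoment μ (Z 0) p c / e ^ p := by
  obtain ⟨C, hC, hmom⟩ := hc.exists_lintegral_rcinar_pow_le h1 hp
  refine ⟨C.toReal, ENNReal.toReal_nonneg, fun c e k he => ?_⟩
  have hS : Measurable (rcinar (fun i ω => natTrunc c (Z i ω)) B k) := _root_.measurable_rcinar
    (fun i _ => (Measurable.of_discrete (f := natTrunc c)).comp (hc.measurable_Z i))
    (fun i _ k => hc.measurable_B i k)
  have hSp : Measurable fun ω =>
      (rcinar (fun i ω => natTrunc c (Z i ω)) B k ω : ENNReal) ^ p :=
    (Measurable.of_discrete (f := fun m : ℕ => (m : ENNReal) ^ p)).comp hS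
  have hmk := mul_meas_ge_le_lintegral (μ := μ) hSp (ENNReal.ofReal e ^ p)
  have hsub : μ {ω | e < (rcinar (fun i ω => natTrunc c (Z i ω)) B k ω : ℝ)} ≤
      μ {ω | ENNReal.ofReal e ^ p ≤
        (rcinar (fun i ω => natTrunc c (Z i ω)) B k ω : ENNReal) ^ p} := by
    refine measure_mono fun ω hω => ?_
    show ENNReal.ofReal e ^ p ≤ _
    refine pow_le_pow_left' ?_ p
    rw [← ENNReal.ofReal_natCast]
    exact ENNReal.ofReal_le_ofReal (le_of_lt hω)
  have hall : ENNReal.ofReal e ^ p *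
      μ {ω | e < (rcinar (fun i ω => natTrunc c (Z i ω)) B k ω : ℝ)} ≤
      C * ∫⁻ ω, (natTrunc c (Z 0 ω) : ENNReal) ^ p ∂μ :=
    (mul_le_mul_right hsub _).trans (hmk.trans (hmom _ k))
  have hfin := ENNReal.toReal_mono
    (ENNReal.mul_ne_top hC (lintegral_natTrunc_lt_top (μ := μ) (Y := Z 0) p c).ne) hall
  rw [ENNReal.toReal_mul, ENNReal.toReal_mul, ENNReal.toReal_pow,
    ENNReal.toReal_ofReal he.le] at hfin
  rw [le_div_iff₀ (by positivity), mul_comm]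
  exact hfin

/-- If no innovation up to time `n` exceeds `K`, truncation changes nothing. The union bound is
crude, but `K` may be taken at a large multiple of the normalizer. -/
lemma measureReal_lt_rcinar_le [IsProbabilityMeasure μ]
    (hc : RCINARCoefficients μ φ Z B) {e d K : ℝ} {n k : ℕ}
    (hk : k ≤ n)
    (hS : μ.real {ω | e < (rcinar (fun i ω => natTrunc K (Z i ω)) B k ω : ℝ)} ≤ d) :
    μ.real {ω | e < (rcinar Z B k ω : ℝ)} ≤ n * natTail μ (Z 0) K + d := by
  have hsub : {ω | e < (rcinar Z B k ω : ℝ)} ⊆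
      (⋃ i ∈ Finset.Icc 1 n, {ω | K < (Z i ω : ℝ)}) ∪
        {ω | e < (rcinar (fun i ω => natTrunc K (Z i ω)) B k ω : ℝ)} := by
    intro ω hω
    by_contra! hcon
    simp only [Set.mem_union, Set.mem_iUnion, not_or, not_exists] at hcon
    refine hcon.2 ?_
    have : rcinar Z B k ω = rcinar (fun i ω => natTrunc K (Z i ω)) B k ω :=
      rcinar_congr fun i hi => (natTrunc_of_le (not_lt.1
        (hcon.1 i (Finset.Icc_subset_Icc_right hk hi)))).symm
    show e < _
    rw [← this]; exact hω
  refine (measureReal_mono hsub).trans ((measureReal_union_le _ _).trans (add_le_add ?_ hS))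
  refine (measureReal_biUnion_finset_le _ _).trans ?_
  calc _ = ∑ i ∈ Finset.Icc 1 n, natTail μ (Z 0) K :=
        Finset.sum_congr rfl fun i _ => by rw [← hc.natTail_eq i]; rfl
    _ ≤ _ := by simp

/-- The maximum of the process exceeds that of the innovations by more than `2 e` only if the
process driven by truncated innovations is large or a large innovation meets a large state. -/
lemma measureReal_runningMax_lt_le [IsProbabilityMeasure μ]
    (hc : RCINARCoefficients μ φ Z B) {c e d D : ℝ} (he : 0 ≤ e)
    {n : ℕ}
    (hd : ∀ k, μ.real {ω | e < (rcinar (fun i ω => natTrunc c (Z i ω)) B k ω : ℝ)} ≤ d)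
    (hD : ∀ k ≤ n, μ.real {ω | e < (rcinar Z B k ω : ℝ)} ≤ D) :
    μ.real {ω | (runningMax Z n ω : ℝ) + 2 * e < runningMax (rcinar Z B) n ω} ≤
      n * d + n * natTail μ (Z 0) c * D := by
  set S := rcinar (fun i ω => natTrunc c (Z i ω)) B with hSdef
  have hsub : {ω | (runningMax Z n ω : ℝ) + 2 * e < runningMax (rcinar Z B) n ω} ⊆
      (⋃ k ∈ Finset.Icc 1 n, {ω | e < (S k ω : ℝ)}) ∪
        ⋃ j ∈ Finset.range n, {ω | c < (Z (j + 1) ω : ℝ)} ∩ {ω | e < (rcinar Z B j ω : ℝ)} := by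
    intro ω hω
    by_contra! hcon
    simp only [Set.mem_union, Set.mem_iUnion, not_or, not_exists, Set.mem_inter_iff,
      Set.mem_ofPred_eq, not_and, not_lt, Finset.mem_range] at hcon
    refine (not_lt.2 ?_) (show (runningMax Z n ω : ℝ) + 2 * e < runningMax (rcinar Z B) n ω from hω)
    rw [runningMax_le_iff (by positivity)]
    intro k hk
    have h1 := rcinar_le_rcinar_natTrunc_add (Z := Z) (B := B) (ω := ω)
      (fun n k => by rcases hc.B_mem n k ω with h | h <;> simp [h]) he (n := n) hcon.2
      (Finset.mem_Icc.1 hk).2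
    have h2 := hcon.1 k hk
    have h3 : (runningMax Z k ω : ℝ) ≤ runningMax Z n ω := by
      exact_mod_cast runningMax_mono_right (Z := Z) (ω := ω) (Finset.mem_Icc.1 hk).2
    linarith
  refine (measureReal_mono hsub).trans ((measureReal_union_le _ _).trans (add_le_add ?_ ?_))
  · refine (measureReal_biUnion_finset_le _ _).trans ?_
    calc _ ≤ ∑ i ∈ Finset.Icc 1 n, d := Finset.sum_le_sum fun k _ => hd k
      _ ≤ _ := by simp
  · refine (measureReal_biUnion_finset_le _ _).trans ?_
    calc _ ≤ ∑ j ∈ Finset.range n, natTail μ (Z 0) c * D := by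
          refine Finset.sum_le_sum fun j hj => ?_
          -- Independence of the new innovation from the preceding state makes the probability of
          -- their joint largeness a product.
          have hi := (hc.indepFun_Z_rcinar (Nat.lt_succ_self j)).measure_inter_preimage_eq_mul
            {m : ℕ | c < (m : ℝ)} {m : ℕ | e < (m : ℝ)} .of_discrete .of_discrete
          have hi' := congrArg ENNReal.toReal hi
          rw [ENNReal.toReal_mul] at hi'
          refine (le_of_eq hi').trans ?_
          rw [← hc.natTail_eq (j + 1)]
          exact mul_le_mul_of_nonneg_left (hD j (Finset.mem_range.1 hj).le) measureReal_nonneg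
      _ = _ := by simp [mul_assoc]

lemma measureReal_runningMax_le [IsProbabilityMeasure μ]
    (hc : RCINARCoefficients μ φ Z B) {r : ℝ} (hr : 0 ≤ r) (n : ℕ) :
    μ.real {ω | (runningMax Z n ω : ℝ) ≤ r} = (1 - natTail μ (Z 0) r) ^ n := by
  have hset : {ω | (runningMax Z n ω : ℝ) ≤ r}
      = ⋂ k ∈ Finset.Icc 1 n, Z k ⁻¹' {m : ℕ | (m : ℝ) ≤ r} := by
    ext ω
    simp only [Set.mem_ofPred_eq, runningMax_le_iff hr, Set.mem_iInter, Set.mem_preimage]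
  have h1 := hc.indep_Z.measure_inter_preimage_eq_mul (Finset.Icc 1 n)
    (sets := fun _ => {m : ℕ | (m : ℝ) ≤ r}) (fun _ _ => .of_discrete)
  rw [hset, measureReal_def, h1, ENNReal.toReal_prod]
  calc _ = ∏ k ∈ Finset.Icc 1 n, (1 - natTail μ (Z 0) r) := by
        refine Finset.prod_congr rfl fun k _ => ?_
        rw [← hc.natTail_eq k, natTail,
          ← probReal_compl_eq_one_sub (measurableSet_natTail (hc.measurable_Z k) r),
          measureReal_def]
        congr 2
        ext ω
        simp
    _ = _ := by simp

end RCINARCoefficients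

/-! ### Limit theorems for the two maxima -/

section Limit

variable {Ω : Type*} [MeasurableSpace Ω] {μ : Measure Ω} [IsProbabilityMeasure μ]
  {φ : ℕ → Ω → ℝ} {Z : ℕ → Ω → ℕ} {B : ℕ → ℕ → Ω → ℕ} {α : ℝ} {h : ℝ → ℝ}

lemma HeavyTailAssumption.tendsto_normalizer (hc : RCINARCoefficients μ φ Z B)
    (ht : HeavyTailAssumption μ φ Z α h) : Tendsto (normalizer h) atTop atTop :=
  _root_.tendsto_normalizer natTail_antitone natTail_nonneg ht.tendsto_tail
    (tendsto_natTail (hc.measurable_Z 0)) ht.bddAbove_tail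

lemma HeavyTailAssumption.tendsto_mul_natTail (hc : RCINARCoefficients μ φ Z B)
    (ht : HeavyTailAssumption μ φ Z α h) {x : ℝ} (hx : 0 < x) :
    Tendsto (fun n : ℕ => (n : ℝ) * natTail μ (Z 0) (x * normalizer h n)) atTop
      (𝓝 (x ^ (-α))) :=
  tendsto_mul_tail_normalizer ht.regularlyVarying natTail_antitone natTail_nonneg ht.tendsto_tail
    (tendsto_natTail (hc.measurable_Z 0)) ht.bddAbove_tail hx

/-- The distribution functions of the normalized maxima of the innovations converge. -/
lemma tendsto_measureReal_runningMax_div (hc : RCINARCoefficients μ φ Z B)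
    (ht : HeavyTailAssumption μ φ Z α h) {x : ℝ} (hx : 0 < x) :
    Tendsto (fun n : ℕ => μ.real {ω | (runningMax Z n ω : ℝ) / normalizer h n ≤ x}) atTop
      (𝓝 (Real.exp (-x ^ (-α)))) := by
  have h1 : Tendsto (fun n : ℕ => (n : ℝ) * -natTail μ (Z 0) (x * normalizer h n)) atTop
      (𝓝 (-x ^ (-α))) := by
    simpa only [mul_neg] using (ht.tendsto_mul_natTail hc hx).neg
  refine (Real.tendsto_one_add_pow_exp_of_tendsto h1).congr' ?_
  filter_upwards [(ht.tendsto_normalizer hc).eventually_gt_atTop 0] with n hn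
  rw [← sub_eq_add_neg, ← hc.measureReal_runningMax_le (by positivity)]
  simp only [div_le_iff₀ hn]

/-- The distribution function of `ν` is given only on `(0, ∞)`; monotonicity and `exp (-y ^ (-α)) →
0` as `y ↓ 0` determine it, and the limit, on `(-∞, 0]`. -/
lemma tendstoInDistribution_runningMax {ν : Measure ℝ} [IsProbabilityMeasure ν]
    (hν : ∀ x : ℝ, 0 < x → cdf ν x = Real.exp (-x ^ (-α)))
    (hc : RCINARCoefficients μ φ Z B) (ht : HeavyTailAssumption μ φ Z α h) :
    TendstoInDistribution (fun (n : ℕ) (ω : Ω) => (runningMax Z n ω : ℝ) / normalizer h n)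
      atTop (id : ℝ → ℝ) (fun _ => μ) ν := by
  refine tendstoInDistribution_of_tendsto_cdf (fun n => ?_) fun x => ?_
  · exact (Measurable.of_discrete (f := fun m : ℕ => (m : ℝ) / normalizer h n)).comp
      (measurable_runningMax hc.measurable_Z n)
  rcases lt_or_ge 0 x with hx | hx
  · rw [hν x hx]; exact tendsto_measureReal_runningMax_div hc ht hx
  have hsmall : Tendsto (fun y : ℝ => Real.exp (-y ^ (-α))) (𝓝[>] 0) (𝓝 0) :=
    Real.tendsto_exp_neg_atTop_nhds_zero.comp
      (tendsto_rpow_neg_nhdsGT_zero (neg_lt_zero.2 ht.α_pos))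
  have hzero : cdf ν x = 0 := by
    refine le_antisymm (ge_of_tendsto hsmall ?_) (cdf_nonneg ν x)
    filter_upwards [self_mem_nhdsWithin] with y hy
    rw [← hν y hy]
    exact monotone_cdf ν (hx.trans (le_of_lt hy))
  rw [hzero]
  refine tendsto_order.2 ⟨fun a ha => Eventually.of_forall fun n => ha.trans_le measureReal_nonneg,
    fun a ha => ?_⟩
  obtain ⟨y, hya, hy⟩ := ((hsmall.eventually (gt_mem_nhds ha)).and self_mem_nhdsWithin).exists
  filter_upwards [(tendsto_measureReal_runningMax_div hc ht hy).eventually (gt_mem_nhds hya)]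
    with n hn
  exact lt_of_le_of_lt (measureReal_mono fun ω hω => hω.trans (hx.trans (le_of_lt hy))) hn

/-- At the scale of the normalizing constants, the maximum of the process exceeds the maximum of
the innovations by a negligible amount. -/
lemma tendsto_measureReal_runningMax_add_lt (hc : RCINARCoefficients μ φ Z B)
    (ht : HeavyTailAssumption μ φ Z α h) {ε : ℝ} (hε : 0 < ε) :
    Tendsto (fun n : ℕ => μ.real {ω | (runningMax Z n ω : ℝ) + 2 * (ε * normalizer h n) <
      runningMax (rcinar Z B) n ω}) atTop (𝓝 0) := by
  have hα := ht.α_pos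
  obtain ⟨p, hp⟩ := exists_nat_gt α
  have hp1 : 1 ≤ p := by
    have : (0 : ℝ) < p := hα.trans hp
    exact_mod_cast this
  obtain ⟨C, hC0, hC⟩ := hc.exists_measureReal_rcinar_natTrunc_le ht.prob_φ_eq_one_lt hp1
  have hF0 := tendsto_natTail (μ := μ) (hc.measurable_Z 0)
  obtain ⟨C', hC'0, hC'⟩ := exists_truncated_moment_le (g := truncMoment μ (Z 0) p)
    ht.regularlyVarying natTail_antitone natTail_nonneg ht.tendsto_tail hp (truncMoment_mono p)
    (fun T hT => truncMoment_two_mul_le (hc.measurable_Z 0) p hT)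
  have hb := ht.tendsto_normalizer hc
  set b := normalizer h with hbdef
  set F := natTail μ (Z 0) with hFdef
  have hFn : ∀ t, 0 ≤ F t := natTail_nonneg
  -- the truncated moment bound, in units of `b n`
  have hmark : ∀ x : ℝ, 0 < x → ∀ᶠ n : ℕ in atTop, ∀ k,
      μ.real {ω | ε * b n < (rcinar (fun i ω => natTrunc (x * b n) (Z i ω)) B k ω : ℝ)} ≤
        C * C' * (x / ε) ^ p * F (x * b n) := by
    intro x hx
    filter_upwards [(hb.const_mul_atTop hx).eventually hC', hb.eventually_gt_atTop 0]
      with n hn hbn k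
    refine (hC (x * b n) (ε * b n) k (by positivity)).trans ?_
    rw [div_le_iff₀ (by positivity)]
    calc C * truncMoment μ (Z 0) p (x * b n) ≤ C * (C' * ((x * b n) ^ p * F (x * b n))) := by gcongr
      _ = _ := by rw [mul_pow, mul_pow, div_pow]; field_simp
  -- the overall bound
  have hbound : ∀ δ K : ℝ, 0 < δ → 0 < K → ∀ᶠ n : ℕ in atTop,
      μ.real {ω | (runningMax Z n ω : ℝ) + 2 * (ε * b n) < runningMax (rcinar Z B) n ω} ≤
        C * C' * (δ / ε) ^ p * (n * F (δ * b n)) +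
          n * F (δ * b n) * (n * F (K * b n) + C * C' * (K / ε) ^ p * F (K * b n)) := by
    intro δ K hδ hK
    filter_upwards [hmark δ hδ, hmark K hK, hb.eventually_gt_atTop 0] with n h1 h2 hbn
    refine (hc.measureReal_runningMax_lt_le (by positivity) h1
      (fun k hk => hc.measureReal_lt_rcinar_le hk (h2 k))).trans (le_of_eq ?_)
    ring
  have hlim : ∀ δ K : ℝ, 0 < δ → 0 < K → Tendsto (fun n : ℕ =>
      C * C' * (δ / ε) ^ p * (n * F (δ * b n)) +
        n * F (δ * b n) * (n * F (K * b n) + C * C' * (K / ε) ^ p * F (K * b n))) atTop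
      (𝓝 (C * C' * (δ / ε) ^ p * δ ^ (-α) +
        δ ^ (-α) * (K ^ (-α) + C * C' * (K / ε) ^ p * 0))) := by
    intro δ K hδ hK
    have h1 := ht.tendsto_mul_natTail hc hδ
    have h2 := ht.tendsto_mul_natTail hc hK
    have h3 := hF0.comp (hb.const_mul_atTop hK)
    exact (h1.const_mul _).add (h1.mul (h2.add (h3.const_mul _)))
  refine tendsto_order.2 ⟨fun a ha => Eventually.of_forall fun n => ha.trans_le measureReal_nonneg,
    fun η hη => ?_⟩
  -- The contribution of the truncated process is of order `δ ^ (p - α)`, which vanishes as `p > α`.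
  have hδlim : Tendsto (fun δ : ℝ => C * C' / ε ^ p * δ ^ ((p : ℝ) - α)) (𝓝[>] 0) (𝓝 0) := by
    have h1 : Tendsto (fun δ : ℝ => δ ^ ((p : ℝ) - α)) (𝓝[>] 0) (𝓝 0) := by
      have := (Real.continuousAt_rpow_const 0 ((p : ℝ) - α) (Or.inr (by linarith))).tendsto
      rw [Real.zero_rpow (by linarith)] at this
      exact this.mono_left nhdsWithin_le_nhds
    simpa using h1.const_mul (C * C' / ε ^ p)
  obtain ⟨δ, hδη, hδ⟩ := ((hδlim.eventually (gt_mem_nhds (half_pos hη))).and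
    self_mem_nhdsWithin).exists
  have hδ : 0 < δ := hδ
  -- `K` is chosen after `δ`, to beat the factor `δ ^ (-α)` counting large innovations.
  have hKlim : Tendsto (fun K : ℝ => δ ^ (-α) * K ^ (-α)) atTop (𝓝 0) := by
    simpa using (tendsto_rpow_neg_atTop hα).const_mul (δ ^ (-α))
  obtain ⟨K, hKη, hK⟩ := ((hKlim.eventually (gt_mem_nhds (half_pos hη))).and
    (eventually_gt_atTop 0)).exists
  have hlt : C * C' * (δ / ε) ^ p * δ ^ (-α) +
      δ ^ (-α) * (K ^ (-α) + C * C' * (K / ε) ^ p * 0) < η := by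
    have : C * C' * (δ / ε) ^ p * δ ^ (-α) = C * C' / ε ^ p * δ ^ ((p : ℝ) - α) := by
      rw [sub_eq_add_neg, Real.rpow_add hδ, Real.rpow_natCast, div_pow]
      ring
    rw [this, mul_zero, add_zero]
    linarith
  filter_upwards [hbound δ K hδ hK, (hlim δ K hδ hK).eventually (gt_mem_nhds hlt)]
    with n h1 h2 using h1.trans_lt h2

/-- Slutsky's argument: the normalized difference of the two maxima tends to zero in probability. -/
lemma tendstoInDistribution_runningMax_rcinar {ν : Measure ℝ} [IsProbabilityMeasure ν]
    (hν : ∀ x : ℝ, 0 < x → cdf ν x = Real.exp (-x ^ (-α)))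
    (hc : RCINARCoefficients μ φ Z B) (ht : HeavyTailAssumption μ φ Z α h) :
    TendstoInDistribution
      (fun (n : ℕ) (ω : Ω) => (runningMax (rcinar Z B) n ω : ℝ) / normalizer h n)
      atTop (id : ℝ → ℝ) (fun _ => μ) ν := by
  refine tendstoInDistribution_of_tendstoInMeasure_sub _ _
    (tendstoInDistribution_runningMax hν hc ht) ?_ fun n => ?_
  · rw [tendstoInMeasure_iff_measureReal_norm]
    intro ε hε
    refine tendsto_of_tendsto_of_tendsto_of_le_of_le' tendsto_const_nhds
      -- The choice `ε / 4` gives an excess threshold of `ε / 2` times the normalizer, so a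
      -- difference of at least `ε` satisfies the strict inequality.
      (tendsto_measureReal_runningMax_add_lt hc ht (show 0 < ε / 4 by positivity))
      (Eventually.of_forall fun n => measureReal_nonneg) ?_
    filter_upwards [(ht.tendsto_normalizer hc).eventually_gt_atTop 0] with n hn
    refine measureReal_mono fun ω hω => ?_
    have hle : (runningMax Z n ω : ℝ) ≤ runningMax (rcinar Z B) n ω := by
      exact_mod_cast runningMax_le_runningMax_rcinar (Z := Z) (B := B) (ω := ω) n
    have hω : ε ≤ ‖(runningMax (rcinar Z B) n ω : ℝ) / normalizer h n
      - (runningMax Z n ω : ℝ) / normalizer h n - 0‖ := hω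
    rw [sub_zero, ← sub_div, Real.norm_of_nonneg (div_nonneg (by linarith) hn.le),
      le_div_iff₀ hn] at hω
    show (runningMax Z n ω : ℝ) + 2 * (ε / 4 * normalizer h n) < runningMax (rcinar Z B) n ω
    nlinarith [mul_pos hε hn]
  · exact ((Measurable.of_discrete (f := fun m : ℕ => (m : ℝ) / normalizer h n)).comp
      (measurable_runningMax hc.measurable_rcinar n)).aemeasurable

end Limit

/-- Choosing `ν` before the probability space, the coefficients and `h` expresses that the limit law
depends on `α` alone. -/
theorem theorem2 (α : ℝ) (hα : 0 < α) :
    ∃ ν : ProbabilityMeasure ℝ,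
      (∀ x : ℝ, 0 < x → cdf (ν : Measure ℝ) x = Real.exp (-x ^ (-α))) ∧
      ∀ (Ω : Type*) [MeasurableSpace Ω] (μ : Measure Ω) [IsProbabilityMeasure μ]
        (φ : ℕ → Ω → ℝ) (Z : ℕ → Ω → ℕ) (B : ℕ → ℕ → Ω → ℕ) (h : ℝ → ℝ),
        RCINARCoefficients μ φ Z B → HeavyTailAssumption μ φ Z α h →
        TendstoInDistribution
            (fun (n : ℕ) (ω : Ω) => (runningMax (rcinar Z B) n ω : ℝ) / normalizer h n)
            atTop (id : ℝ → ℝ) (fun _ => μ) (ν : Measure ℝ) ∧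
          TendstoInDistribution
            (fun (n : ℕ) (ω : Ω) => (runningMax Z n ω : ℝ) / normalizer h n)
            atTop (id : ℝ → ℝ) (fun _ => μ) (ν : Measure ℝ) := by
  obtain ⟨ν, hν⟩ := exists_frechet hα
  exact ⟨ν, hν, fun Ω _ μ _ φ Z B h hc ht =>
    ⟨tendstoInDistribution_runningMax_rcinar hν hc ht, tendstoInDistribution_runningMax hν hc ht⟩⟩
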